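/- Let $f\neq 0$ and $g\neq 0$ be real constants and consider the rotating shallow water equations $$u_t+uu_x+vu_y-fv+gh_x=0,\qquad v_t+uv_x+vv_y+fu+gh_y=0,\qquad h_t+(uh)_x+(vh)_y=0$$ for $(u,v,h)$ as functions of $(t,x,y)$. Write $(x^1,x^2,x^3)=(t,x,y)$ and $(u^1,u^2,u^3)=(u,v,h)$. An infinitesimal point symmetry of this system on an open set $W\subseteq\mathbb R^6$ of points $(t,x,y,u,v,h)$ is a smooth vector field $X=\sum_i\xi^i\partial_{x^i}+\sum_j\eta^j\partial_{u^j}$ on $W$ whose first prolongation $$Y=X+\sum_{i,j}\zeta^j_i\,\partial_{u^j_i},\qquad \zeta^j_i=D_i\eta^j-\sum_l u^j_l D_i\xi^l,\qquad D_i=\partial_{x^i}+\sum_k u^k_i\partial_{u^k},$$ annihilates the left-hand sides of the three equations at every point $(x^i,u^j,u^j_i)$ of the first-order jet space over $W$ at which the three equations hold. **Theorem.** Let $W\subseteq\mathbb R^6$ be a nonempty connected open set (for example $W=\mathbb R^6$ or $W=\{h>0\}$). The infinitesimal point symmetries on $W$ form a Lie algebra $L_9^f$ under the Lie bracket of vector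 fields. It has dimension $9$, and the restrictions to $W$ of the following vector fields are a basis of it: $$X_1=\partial_x,\quad X_2=\partial_y,\quad X_7=\partial_t,$$ $$X_3=\cos(ft)\partial_x-\sin(ft)\partial_y-f\sin(ft)\partial_u-f\cos(ft)\partial_v,$$ $$X_4=\sin(ft)\partial_x+\cos(ft)\partial_y+f\cos(ft)\partial_u-f\sin(ft)\partial_v,$$ $$X_5=-y\partial_x+x\partial_y-v\partial_u+u\partial_v,\qquad X_6=x\partial_x+y\partial_y+u\partial_u+v\partial_v+2h\partial_h,$$ $$\begin{aligned}X_8={}&\cos(ft)\partial_t-\tfrac f2\bigl(x\sin(ft)-y\cos(ft)\bigr)\partial_x-\tfrac f2\bigl(x\cos(ft)+y\sin(ft)\bigr)\partial_y\\&+\tfrac f2\bigl((u-fy)\sin(ft)+(v-fx)\cos(ft)\bigr)\partial_u-\tfrac f2\bigl((u+fy)\cos(ft)-(v+fx)\sin(ft)\bigr)\partial_v+fh\sin(ft)\partial_h,\end{aligned}$$ $$\begin{aligned}X_9={}&\sin(ft)\partial_t+\tfrac f2\bigl(x\cos(ft)+y\sin(ft)\bigr)\partial_x-\tfrac f2\bigl(x\sin(ft)-y\cos(ft)\bigr)\partial_y\\&-\tfrac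 f2\bigl((u-fy)\cos(ft)-(v-fx)\sin(ft)\bigr)\partial_u-\tfrac f2\bigl((u+fy)\sin(ft)+(v+fx)\cos(ft)\bigr)\partial_v-fh\cos(ft)\partial_h.\end{aligned}$$ -/

import Mathlib

open scoped ContDiff

noncomputable section

namespace RSW

/-- The space `ℝ³ × ℝ³` of independent variables `𝐱 = (x⁰, x¹, x²) = (t, x, y)` and dependent
variables `𝐮 = (u⁰, u¹, u²) = (u, v, h)`. -/
abbrev BaseSpace : Type := (Fin 3 → ℝ) × (Fin 3 → ℝ)

/-- The first-order jet space. A point is `((𝐱, 𝐮), p)`, where `p j i` is the jet coordinate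
`uʲᵢ = ∂uʲ/∂xⁱ`. -/
abbrev JetSpace : Type := BaseSpace × (Fin 3 → Fin 3 → ℝ)

/-! ### The Lie algebra of smooth vector fields on an open set -/

/-- Smooth vector fields on the open set `W`, as functions on the whole space normalized to be `0`
outside `W` (so that two of them are equal iff they agree on `W`). -/
def smoothFields (W : TopologicalSpace.Opens BaseSpace) :
    Submodule ℝ (BaseSpace → BaseSpace) where
  carrier := {X | ContDiffOn ℝ ∞ X W ∧ ∀ b ∉ W, X b = 0}
  add_mem' := by
    rintro X Y ⟨hX, hX0⟩ ⟨hY, hY0⟩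
    exact ⟨hX.add hY, fun b hb => by simp [hX0 b hb, hY0 b hb]⟩
  zero_mem' := ⟨contDiffOn_const, fun _ _ => rfl⟩
  smul_mem' := by
    rintro c X ⟨hX, hX0⟩
    exact ⟨hX.const_smul c, fun b hb => by simp [hX0 b hb]⟩

/-- The type of smooth vector fields
`X = ξ⁰ ∂_t + ξ¹ ∂_x + ξ² ∂_y + η⁰ ∂_u + η¹ ∂_v + η² ∂_h` on the open set `W`;
`ξⁱ` is `fun b => (X b).1 i` and `ηʲ` is `fun b => (X b).2 j`. -/
def SmoothVectorField (W : TopologicalSpace.Opens BaseSpace) : Type := smoothFields W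

namespace SmoothVectorField

variable {W : TopologicalSpace.Opens BaseSpace}

instance : AddCommGroup (SmoothVectorField W) := inferInstanceAs (AddCommGroup (smoothFields W))

instance : Module ℝ (SmoothVectorField W) := inferInstanceAs (Module ℝ (smoothFields W))

/-- The underlying function of a vector field. -/
def toFun (X : SmoothVectorField W) : BaseSpace → BaseSpace := X.1

instance : CoeFun (SmoothVectorField W) (fun _ => BaseSpace → BaseSpace) := ⟨toFun⟩

theorem ext_on {X Y : SmoothVectorField W} (h : ∀ b ∈ W, X b = Y b) : X = Y := by
  apply Subtype.ext
  funext b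
  by_cases hb : b ∈ W
  · exact h b hb
  · exact (X.2.2 b hb).trans (Y.2.2 b hb).symm

@[simp] theorem add_apply (X Y : SmoothVectorField W) (b : BaseSpace) :
    (X + Y) b = X b + Y b := rfl

@[simp] theorem smul_apply (c : ℝ) (X : SmoothVectorField W) (b : BaseSpace) :
    (c • X) b = c • X b := rfl

@[simp] theorem zero_apply (b : BaseSpace) : (0 : SmoothVectorField W) b = 0 := rfl

theorem contDiffAt (X : SmoothVectorField W) {b : BaseSpace} (hb : b ∈ W) :
    ContDiffAt ℝ ∞ X b :=
  X.2.1.contDiffAt (W.isOpen.mem_nhds hb)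

theorem differentiableAt (X : SmoothVectorField W) {b : BaseSpace} (hb : b ∈ W) :
    DifferentiableAt ℝ X b :=
  (X.contDiffAt hb).differentiableAt (by simp)

open Classical in
/-- The restriction to `W` of a globally defined smooth vector field. -/
def restrict (W : TopologicalSpace.Opens BaseSpace) (X : BaseSpace → BaseSpace)
    (hX : ContDiff ℝ ∞ X) : SmoothVectorField W :=
  ⟨fun b => if b ∈ W then X b else 0,
    hX.contDiffOn.congr (fun _ hb => if_pos hb), fun _ hb => if_neg hb⟩

theorem restrict_apply (X : BaseSpace → BaseSpace) (hX : ContDiff ℝ ∞ X) {b : BaseSpace}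
    (hb : b ∈ W) : restrict W X hX b = X b := if_pos hb

open Classical in
/-- The Lie bracket of vector fields on `W`: at points of `W` it is
`[X, Y] = DY · X - DX · Y`, that is, `[X, Y] F = X (Y F) - Y (X F)` on functions. -/
instance : Bracket (SmoothVectorField W) (SmoothVectorField W) where
  bracket X Y :=
    ⟨fun b => if b ∈ W then VectorField.lieBracket ℝ X Y b else 0, by
      refine ⟨fun b hb => ?_, fun _ hb => if_neg hb⟩
      have h : ContDiffAt ℝ ∞ (VectorField.lieBracket ℝ X Y) b :=
        ContDiffAt.lieBracket_vectorField (n := ∞) (X.contDiffAt hb) (Y.contDiffAt hb) (by simp)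
      refine (h.congr_of_eventuallyEq ?_).contDiffWithinAt
      filter_upwards [W.isOpen.mem_nhds hb] with c hc
      exact if_pos hc⟩

theorem bracket_apply (X Y : SmoothVectorField W) {b : BaseSpace} (hb : b ∈ W) :
    ⁅X, Y⁆ b = VectorField.lieBracket ℝ X Y b := if_pos hb

theorem bracket_eventuallyEq (X Y : SmoothVectorField W) {b : BaseSpace} (hb : b ∈ W) :
    (⁅X, Y⁆ : SmoothVectorField W).toFun =ᶠ[nhds b] VectorField.lieBracket ℝ X Y := by
  filter_upwards [W.isOpen.mem_nhds hb] with c hc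
  exact bracket_apply X Y hc

instance : LieRing (SmoothVectorField W) where
  add_lie X Y Z := ext_on fun b hb => by
    rw [add_apply, bracket_apply _ _ hb, bracket_apply _ _ hb, bracket_apply _ _ hb]
    exact VectorField.lieBracket_add_left (X.differentiableAt hb) (Y.differentiableAt hb)
  lie_add X Y Z := ext_on fun b hb => by
    rw [add_apply, bracket_apply _ _ hb, bracket_apply _ _ hb, bracket_apply _ _ hb]
    exact VectorField.lieBracket_add_right (Y.differentiableAt hb) (Z.differentiableAt hb)
  lie_self X := ext_on fun b hb => by
    rw [bracket_apply _ _ hb]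
    simp
  leibniz_lie X Y Z := ext_on fun b hb => by
    rw [add_apply, bracket_apply _ _ hb, bracket_apply _ _ hb, bracket_apply _ _ hb,
      (Filter.EventuallyEq.refl _ _).lieBracket_vectorField_eq (bracket_eventuallyEq Y Z hb),
      (bracket_eventuallyEq X Y hb).lieBracket_vectorField_eq (Filter.EventuallyEq.refl _ _),
      (Filter.EventuallyEq.refl _ _).lieBracket_vectorField_eq (bracket_eventuallyEq X Z hb)]
    exact VectorField.leibniz_identity_lieBracket (n := ∞)
      (by rw [minSmoothness_of_isRCLikeNormedField]; exact WithTop.coe_le_coe.2 le_top)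
      (X.contDiffAt hb) (Y.contDiffAt hb) (Z.contDiffAt hb)

instance : LieAlgebra ℝ (SmoothVectorField W) where
  lie_smul c X Y := ext_on fun b hb => by
    rw [smul_apply, bracket_apply _ _ hb, bracket_apply _ _ hb]
    exact VectorField.lieBracket_const_smul_right (Y.differentiableAt hb)

end SmoothVectorField

/-! ### Prolongation and infinitesimal invariance -/

/-- The total derivative `Dᵢ F = ∂F/∂xⁱ + ∑ₖ uᵏᵢ ∂F/∂uᵏ` at the jet `z` of a function `F` of
`(𝐱, 𝐮)`. -/
def totalDeriv (i : Fin 3) (F : BaseSpace → ℝ) (z : JetSpace) : ℝ :=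
  fderiv ℝ F z.1 (Pi.single i 1, fun k => z.2 k i)

/-- The first prolongation `X + ∑ ζʲᵢ ∂/∂uʲᵢ` of the vector field `X` at the jet `z`, with
`ζʲᵢ = Dᵢ ηʲ - ∑ₗ uʲₗ Dᵢ ξˡ`. -/
def prolong (X : BaseSpace → BaseSpace) (z : JetSpace) : JetSpace :=
  (X z.1, fun j i => totalDeriv i (fun b => (X b).2 j) z
    - ∑ l, z.2 j l * totalDeriv i (fun b => (X b).1 l) z)

/-- The vector field `X` on `W` is an infinitesimal point symmetry of the first-order system of
differential equations `F (𝐱, 𝐮, ∂𝐮) = 0`: the prolongation of `X` annihilates `F` at every jet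
over `W` that satisfies the system. -/
def IsPointSymmetry (F : JetSpace → Fin 3 → ℝ) {W : TopologicalSpace.Opens BaseSpace}
    (X : SmoothVectorField W) : Prop :=
  ∀ z : JetSpace, z.1 ∈ W → F z = 0 → fderiv ℝ F z (prolong X z) = 0

/-! ### The rotating shallow water equations and their symmetries -/

/-- The left-hand sides of the rotating shallow water equations
`u_t + u u_x + v u_y - f v + g h_x = 0`, `v_t + u v_x + v v_y + f u + g h_y = 0`,
`h_t + (u h)_x + (v h)_y = 0`. -/
def equations (f g : ℝ) (z : JetSpace) : Fin 3 → ℝ :=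
  let u := z.1.2 0
  let v := z.1.2 1
  let h := z.1.2 2
  let p := z.2
  ![p 0 0 + u * p 0 1 + v * p 0 2 - f * v + g * p 2 1,
    p 1 0 + u * p 1 1 + v * p 1 2 + f * u + g * p 2 2,
    p 2 0 + (p 0 1 * h + u * p 2 1) + (p 1 2 * h + v * p 2 2)]

/-- The vector fields `X₁, …, X₉` on `ℝ⁶` (`generator f k` is `X_{k+1}`), each written as
`(![ξᵗ, ξˣ, ξʸ], ![ηᵘ, ηᵛ, ηʰ])`. -/
def generator (f : ℝ) (k : Fin 9) (b : BaseSpace) : BaseSpace :=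
  let t := b.1 0
  let x := b.1 1
  let y := b.1 2
  let u := b.2 0
  let v := b.2 1
  let h := b.2 2
  let c := Real.cos (f * t)
  let s := Real.sin (f * t)
  (![(![0, 1, 0], ![0, 0, 0]),
     (![0, 0, 1], ![0, 0, 0]),
     (![0, c, -s], ![-(f * s), -(f * c), 0]),
     (![0, s, c], ![f * c, -(f * s), 0]),
     (![0, -y, x], ![-v, u, 0]),
     (![0, x, y], ![u, v, 2 * h]),
     (![1, 0, 0], ![0, 0, 0]),
     (![c, -(f / 2 * (x * s - y * c)), -(f / 2 * (x * c + y * s))],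
      ![f / 2 * ((u - f * y) * s + (v - f * x) * c),
        -(f / 2 * ((u + f * y) * c - (v + f * x) * s)),
        f * h * s]),
     (![s, f / 2 * (x * c + y * s), -(f / 2 * (x * s - y * c))],
      ![-(f / 2 * ((u - f * y) * c - (v - f * x) * s)),
        -(f / 2 * ((u + f * y) * s + (v + f * x) * c)),
        -(f * h * c)])] : Fin 9 → BaseSpace) k

theorem contDiff_generator (f : ℝ) (k : Fin 9) : ContDiff ℝ ∞ (generator f k) := by
  unfold generator
  fin_cases k <;>
  · refine ContDiff.prodMk (contDiff_pi.2 fun i => ?_) (contDiff_pi.2 fun i => ?_) <;>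
    fin_cases i <;> simp <;> fun_prop

/-- The restrictions to `W` of the vector fields `X₁, …, X₉`. -/
def generatorOn (f : ℝ) (W : TopologicalSpace.Opens BaseSpace) (k : Fin 9) :
    SmoothVectorField W :=
  SmoothVectorField.restrict W (generator f k) (contDiff_generator f k)

end RSW

end

/-! On solution jets the invariance condition is a polynomial of degree at most two in the six free
jet coordinates. Its coefficients form an overdetermined linear system
(`determiningSystem_of_linearizedEquations`): locally ξᵗ depends on t only, (ξˣ, ξʸ) depends on t,
x, y and is conformal in (x, y), and η is expressed through first derivatives of ξ. Reading off
coefficients divides by h, so this is done where h ≠ 0 and extended by density.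

Put a = ξˣ_x and b = ξˣ_y. Differentiating the rest of the system in u and v gives a_x = a_y = b_y =
0, ξᵗ_tt = 2 a_t, 2 b_t = f ξᵗ_t, ξˣ_tt = f ξʸ_t, ξʸ_tt = -f ξˣ_t, whence 2 a_tt = -f² ξᵗ_t. So all
derivatives of the nine functions ξᵗ, ξˣ, ξʸ, ξᵗ_t, ξˣ_t, ξʸ_t, a, b, a_t are linear in these
functions, and at most nine constants are free.

In place of a uniqueness theorem, nine explicit `firstIntegrals` are shown to have zero derivative
(`derivation_firstIntegrals_eq_zero`), hence to be constant on connected W. By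
`eq_sum_firstIntegrals` they are the coefficients of 2f² X in X₁, …, X₉. Conversely, each generator
satisfies the condition by substitution; the first integrals are dual to the generators up to the
factor 2f² ≠ 0, which gives independence; an explicit table gives closure under the bracket. -/

open scoped ContDiff

noncomputable section

namespace RSW

/-! ### The algebra of smooth functions on an open set -/

section SmoothFunctions

variable {E : Type*} [NormedAddCommGroup E] {W : TopologicalSpace.Opens E}

open Classical in
/-- The extension by zero of a function on `W`. -/
def extendZero (φ : W → ℝ) (b : E) : ℝ := if hb : b ∈ W then φ ⟨b, hb⟩ else 0

theorem extendZero_apply (φ : W → ℝ) (b : W) : extendZero φ b = φ b := dif_pos b.2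

/-- Since W is open, derivatives at its points ignore values outside W; any formula valid on W may
replace the extension by zero. -/
theorem eventuallyEq_nhds_of_forall_mem {F : Type*} {G G' : E → F} (h : ∀ b : W, G b = G' b)
    (b : W) : G =ᶠ[nhds (b : E)] G' := by
  filter_upwards [W.isOpen.mem_nhds b.2] with c hc
  exact h ⟨c, hc⟩

variable [NormedSpace ℝ E]

theorem contDiffAt_extendZero_of_forall {φ : W → ℝ} {G : E → ℝ} (h : ∀ b : W, φ b = G b)
    (b : W) (hG : ContDiffAt ℝ ∞ G b) : ContDiffAt ℝ ∞ (extendZero φ) b :=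
  hG.congr_of_eventuallyEq
    (eventuallyEq_nhds_of_forall_mem (fun c => by rw [extendZero_apply, h]) b)

variable (W) in
/-- The algebra of smooth real functions on the open set `W`. -/
def smoothFunctions : Subalgebra ℝ (W → ℝ) where
  carrier := {φ | ∀ b : W, ContDiffAt ℝ ∞ (extendZero φ) b}
  mul_mem' {φ ψ} hφ hψ b :=
    contDiffAt_extendZero_of_forall (G := fun c => extendZero φ c * extendZero ψ c)
      (fun c => by simp [extendZero_apply]) b ((hφ b).mul (hψ b))
  add_mem' {φ ψ} hφ hψ b :=
    contDiffAt_extendZero_of_forall (G := fun c => extendZero φ c + extendZero ψ c)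
      (fun c => by simp [extendZero_apply]) b ((hφ b).add (hψ b))
  algebraMap_mem' r b :=
    contDiffAt_extendZero_of_forall (G := fun _ => r) (fun c => rfl) b contDiffAt_const

namespace smoothFunctions

/-- The restriction to `W` of a function that is smooth at every point of `W`. -/
def ofContDiffAt (G : E → ℝ) (hG : ∀ b : W, ContDiffAt ℝ ∞ G b) : smoothFunctions W :=
  ⟨fun b => G b, fun b => contDiffAt_extendZero_of_forall (fun _ => rfl) b (hG b)⟩

theorem differentiableAt_extendZero (φ : smoothFunctions W) (b : W) :
    DifferentiableAt ℝ (extendZero φ.1) b :=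
  (φ.2 b).differentiableAt (by simp)

theorem contDiffAt_fderiv_apply {G : E → ℝ} {b : E} (hG : ContDiffAt ℝ ∞ G b) (w : E) :
    ContDiffAt ℝ ∞ (fun c => fderiv ℝ G c w) b :=
  (hG.fderiv_right (m := ∞) (by simp)).clm_apply contDiffAt_const

/-- The derivative in the constant direction `w`, as a derivation of the smooth functions. -/
def dirDeriv (w : E) : Derivation ℝ (smoothFunctions W) (smoothFunctions W) :=
  Derivation.mk'
    { toFun := fun φ => ofContDiffAt (fun c => fderiv ℝ (extendZero φ.1) c w)
        fun b => contDiffAt_fderiv_apply (φ.2 b) w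
      map_add' := fun φ ψ => Subtype.ext <| funext fun b => by
        change fderiv ℝ (extendZero (φ + ψ).1) b w
          = fderiv ℝ (extendZero φ.1) b w + fderiv ℝ (extendZero ψ.1) b w
        rw [Filter.EventuallyEq.fderiv_eq (eventuallyEq_nhds_of_forall_mem
          (G' := fun c => extendZero φ.1 c + extendZero ψ.1 c)
          (fun c => by simp [extendZero_apply]) b),
          fderiv_fun_add (differentiableAt_extendZero φ b) (differentiableAt_extendZero ψ b)]
        rfl
      map_smul' := fun r φ => Subtype.ext <| funext fun b => by
        change fderiv ℝ (extendZero (r • φ).1) b w = r * fderiv ℝ (extendZero φ.1) b w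
        rw [Filter.EventuallyEq.fderiv_eq (eventuallyEq_nhds_of_forall_mem
          (G' := fun c => r • extendZero φ.1 c) (fun c => by simp [extendZero_apply]) b),
          fderiv_fun_const_smul (differentiableAt_extendZero φ b)]
        rfl }
    fun φ ψ => Subtype.ext <| funext fun b => by
      change fderiv ℝ (extendZero (φ * ψ).1) b w
        = φ.1 b * fderiv ℝ (extendZero ψ.1) b w + ψ.1 b * fderiv ℝ (extendZero φ.1) b w
      rw [Filter.EventuallyEq.fderiv_eq (eventuallyEq_nhds_of_forall_mem
        (G' := fun c => extendZero φ.1 c * extendZero ψ.1 c)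
        (fun c => by simp [extendZero_apply]) b),
        fderiv_fun_mul (differentiableAt_extendZero φ b) (differentiableAt_extendZero ψ b)]
      simp [extendZero_apply]

theorem dirDeriv_apply (w : E) (φ : smoothFunctions W) (b : W) :
    (dirDeriv w φ).1 b = fderiv ℝ (extendZero φ.1) b w := rfl

theorem dirDeriv_apply_of_forall (w : E) {φ : smoothFunctions W} {G : E → ℝ}
    (h : ∀ b : W, φ.1 b = G b) (b : W) : (dirDeriv w φ).1 b = fderiv ℝ G b w := by
  rw [dirDeriv_apply, Filter.EventuallyEq.fderiv_eq (eventuallyEq_nhds_of_forall_mem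
    (G' := G) (fun c => by rw [extendZero_apply, h]) b)]

/-- Symmetry of second derivatives; it supplies the integrability conditions of the determining
system. -/
theorem dirDeriv_comm (w w' : E) (φ : smoothFunctions W) :
    dirDeriv w (dirDeriv w' φ) = dirDeriv w' (dirDeriv w φ) := by
  have key : ∀ (w w' : E) (b : W), (dirDeriv w (dirDeriv w' φ)).1 b
      = fderiv ℝ (fderiv ℝ (extendZero φ.1)) b w w' := fun w w' b => by
    rw [dirDeriv_apply_of_forall (G := fun c => fderiv ℝ (extendZero φ.1) c w') w
        (fun c => dirDeriv_apply w' φ c) b,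
      fderiv_clm_apply (((φ.2 b).fderiv_right (m := ∞) (by simp)).differentiableAt (by simp))
        (differentiableAt_const _)]
    simp
  refine Subtype.ext <| funext fun b => ?_
  rw [key, key]
  refine (ContDiffAt.isSymmSndFDerivAt (φ.2 b) ?_) w w'
  rw [minSmoothness_of_isRCLikeNormedField]
  exact WithTop.coe_le_coe.2 le_top

/-- On a connected open set, a smooth function with vanishing derivatives is constant. -/
theorem exists_eq_const (hW : IsConnected (W : Set E)) (φ : smoothFunctions W)
    (h : ∀ w, dirDeriv w φ = 0) : ∃ r : ℝ, ∀ b : W, φ.1 b = r := by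
  obtain ⟨b₀, hb₀⟩ := hW.nonempty
  refine ⟨φ.1 ⟨b₀, hb₀⟩, fun b => ?_⟩
  rw [← extendZero_apply φ.1 b, ← extendZero_apply φ.1 ⟨b₀, hb₀⟩]
  refine W.isOpen.is_const_of_fderiv_eq_zero (𝕜 := ℝ) hW.isPreconnected
    (fun c hc => (differentiableAt_extendZero φ ⟨c, hc⟩).differentiableWithinAt)
    (fun c hc => ?_) b.2 hb₀
  ext w
  exact (dirDeriv_apply w φ ⟨c, hc⟩).symm.trans (by rw [h w]; rfl)

/-- A smooth function that vanishes on a dense set vanishes. -/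
theorem eq_zero_of_forall_frequently (φ : smoothFunctions W)
    (h : ∀ b : W, ∃ᶠ c in nhds (b : E), extendZero φ.1 c = 0) : φ = 0 := by
  refine Subtype.ext <| funext fun b => ?_
  by_contra hb
  refine h b ?_
  refine (differentiableAt_extendZero φ b).continuousAt.eventually_ne ?_
  rw [extendZero_apply]
  exact hb

end smoothFunctions

end SmoothFunctions

/-! ### The determining equations -/

/-- The determining equations for the components `Z = (ξᵗ, ξˣ, ξʸ, ηᵘ, ηᵛ, ηʰ)` of a point symmetry,
where `M k l` is the derivative of `Z k` with respect to the `l`-th of the variables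
`(t, x, y, u, v, h)`. -/
structure DeterminingSystem {A : Type*} [CommRing A] (f g u v h : A) (Z : Fin 6 → A)
    (M : Fin 6 → Fin 6 → A) : Prop where
  t_x : M 0 1 = 0
  t_y : M 0 2 = 0
  t_u : M 0 3 = 0
  t_v : M 0 4 = 0
  t_h : M 0 5 = 0
  x_u : M 1 3 = 0
  x_v : M 1 4 = 0
  x_h : M 1 5 = 0
  y_u : M 2 3 = 0
  y_v : M 2 4 = 0
  y_h : M 2 5 = 0
  y_x : M 2 1 = -M 1 2
  y_y : M 2 2 = M 1 1
  u_eq : Z 3 = M 1 0 + u * (M 1 1 - M 0 0) + v * M 1 2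
  v_eq : Z 4 = M 2 0 - u * M 1 2 + v * (M 1 1 - M 0 0)
  h_eq : Z 5 = 2 * h * (M 1 1 - M 0 0)
  momentum_u : M 3 0 + u * M 3 1 + v * M 3 2 + f * v * M 3 3 - f * u * M 3 4
    - f * v * M 0 0 - f * Z 4 + g * M 5 1 = 0
  momentum_v : M 4 0 + u * M 4 1 + v * M 4 2 + f * v * M 4 3 - f * u * M 4 4
    + f * u * M 0 0 + f * Z 3 + g * M 5 2 = 0
  mass : M 5 0 + u * M 5 1 + v * M 5 2 + h * (M 3 1 + M 4 2) = 0

/-- The linearization of the shallow water equations, at the jet `p` over a point, along the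
prolongation of a vector field with components `Z` and matrix of derivatives `M`. -/
def linearizedEquations (f g u v h : ℝ) (Z : Fin 6 → ℝ) (M : Fin 6 → Fin 6 → ℝ)
    (p : Fin 3 → Fin 3 → ℝ) : Fin 3 → ℝ :=
  let D (i : Fin 3) (k : Fin 6) : ℝ :=
    M k (Fin.castAdd 3 i) + (p 0 i * M k 3 + p 1 i * M k 4 + p 2 i * M k 5)
  let ζ (j i : Fin 3) : ℝ :=
    D i (Fin.natAdd 3 j) - (p j 0 * D i 0 + p j 1 * D i 1 + p j 2 * D i 2)
  ![ζ 0 0 + (Z 3 * p 0 1 + u * ζ 0 1) + (Z 4 * p 0 2 + v * ζ 0 2) - f * Z 4 + g * ζ 2 1,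
    ζ 1 0 + (Z 3 * p 1 1 + u * ζ 1 1) + (Z 4 * p 1 2 + v * ζ 1 2) + f * Z 3 + g * ζ 2 2,
    ζ 2 0 + (ζ 0 1 * h + p 0 1 * Z 5 + (Z 3 * p 2 1 + u * ζ 2 1))
      + (ζ 1 2 * h + p 1 2 * Z 5 + (Z 4 * p 2 2 + v * ζ 2 2))]

/-- The jet over a point with the spatial derivatives
`(u_x, u_y, v_x, v_y, h_x, h_y) = (a₁, a₂, b₁, b₂, c₁, c₂)` that satisfies the shallow water
equations. -/
def solutionJet (f g u v h a₁ a₂ b₁ b₂ c₁ c₂ : ℝ) : Fin 3 → Fin 3 → ℝ :=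
  ![![-(u * a₁ + v * a₂ - f * v + g * c₁), a₁, a₂],
    ![-(u * b₁ + v * b₂ + f * u + g * c₂), b₁, b₂],
    ![-(a₁ * h + u * c₁ + b₂ * h + v * c₂), c₁, c₂]]

/-- The hypothesis says that three polynomials of degree at most two in (a₁, …, c₂) vanish
identically. A mixed second difference extracts the coefficient of a product, half a central
difference extracts a linear coefficient, and the value at 0 is the constant term. -/
theorem determiningSystem_of_linearizedEquations {f g u v h : ℝ} (hg : g ≠ 0) (hh : h ≠ 0)
    {Z : Fin 6 → ℝ} {M : Fin 6 → Fin 6 → ℝ}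
    (H : ∀ a₁ a₂ b₁ b₂ c₁ c₂, linearizedEquations f g u v h Z M
      (solutionJet f g u v h a₁ a₂ b₁ b₂ c₁ c₂) = 0) :
    DeterminingSystem f g u v h Z M := by
  have e1 := fun a₁ a₂ b₁ b₂ c₁ c₂ => congrFun (H a₁ a₂ b₁ b₂ c₁ c₂) 0
  have e2 := fun a₁ a₂ b₁ b₂ c₁ c₂ => congrFun (H a₁ a₂ b₁ b₂ c₁ c₂) 1
  have e3 := fun a₁ a₂ b₁ b₂ c₁ c₂ => congrFun (H a₁ a₂ b₁ b₂ c₁ c₂) 2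
  have i3 : Fin.natAdd 3 (0 : Fin 3) = (3 : Fin 6) := rfl
  have i4 : Fin.natAdd 3 (1 : Fin 3) = (4 : Fin 6) := rfl
  have i5 : Fin.natAdd 3 (2 : Fin 3) = (5 : Fin 6) := rfl
  have j0 : Fin.castAdd 3 (0 : Fin 3) = (0 : Fin 6) := rfl
  have j1 : Fin.castAdd 3 (1 : Fin 3) = (1 : Fin 6) := rfl
  have j2 : Fin.castAdd 3 (2 : Fin 3) = (2 : Fin 6) := rfl
  simp only [linearizedEquations, solutionJet, i3, i4, i5, j0, j1, j2, Matrix.cons_val,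
    Pi.zero_apply] at e1 e2 e3
  clear H
  have t_v : M 0 4 = 0 := by
    refine (mul_eq_zero_iff_right (mul_ne_zero hg hh)).1 ?_
    linear_combination e1 1 0 1 0 0 0 - e1 1 0 0 0 0 0 - e1 0 0 1 0 0 0 + e1 0 0 0 0 0 0
  have t_u : M 0 3 = 0 := by
    refine (mul_eq_zero_iff_right (mul_ne_zero hg hh)).1 ?_
    linear_combination e2 1 1 0 0 0 0 - e2 1 0 0 0 0 0 - e2 0 1 0 0 0 0 + e2 0 0 0 0 0 0
  have t_h : M 0 5 = 0 := by
    refine (mul_eq_zero_iff_right (mul_ne_zero hh hh)).1 ?_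
    linear_combination (-1 / 2) * (e3 1 0 0 1 0 0 - e3 1 0 0 0 0 0 - e3 0 0 0 1 0 0
      + e3 0 0 0 0 0 0)
  simp only [t_u, t_v, t_h, mul_zero, add_zero] at e1 e2 e3
  have x_u : M 1 3 = 0 := by
    refine (mul_eq_zero_iff_right hg).1 ?_
    linear_combination e2 0 0 1 0 1 0 - e2 0 0 1 0 0 0 - e2 0 0 0 0 1 0 + e2 0 0 0 0 0 0
  have x_v : M 1 4 = 0 := by
    refine (mul_eq_zero_iff_right hg).1 ?_
    linear_combination -(e1 0 0 1 0 1 0 - e1 0 0 1 0 0 0 - e1 0 0 0 0 1 0 + e1 0 0 0 0 0 0)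
  have x_h : M 1 5 = 0 := by
    refine (mul_eq_zero_iff_right hh).1 ?_
    linear_combination e2 1 0 1 0 0 0 - e2 1 0 0 0 0 0 - e2 0 0 1 0 0 0 + e2 0 0 0 0 0 0
  have y_u : M 2 3 = 0 := by
    refine (mul_eq_zero_iff_right hg).1 ?_
    linear_combination e1 0 1 0 0 1 0 - e1 0 1 0 0 0 0 - e1 0 0 0 0 1 0 + e1 0 0 0 0 0 0
  have y_v : M 2 4 = 0 := by
    refine (mul_eq_zero_iff_right hg).1 ?_
    linear_combination e1 0 1 0 0 0 1 - e1 0 1 0 0 0 0 - e1 0 0 0 0 0 1 + e1 0 0 0 0 0 0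
  have y_h : M 2 5 = 0 := by
    refine (mul_eq_zero_iff_right hh).1 ?_
    linear_combination e1 1 1 0 0 0 0 - e1 1 0 0 0 0 0 - e1 0 1 0 0 0 0 + e1 0 0 0 0 0 0
  simp only [x_u, x_v, x_h, y_u, y_v, y_h, mul_zero, add_zero] at e1 e2 e3
  have h_u : M 5 3 = 0 := by
    refine (mul_eq_zero_iff_right hg).1 ?_
    linear_combination (1 / 2) * (e2 0 1 0 0 0 0 - e2 0 (-1) 0 0 0 0)
  have h_v : M 5 4 = 0 := by
    refine (mul_eq_zero_iff_right hg).1 ?_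
    linear_combination (1 / 2) * (e1 0 0 1 0 0 0 - e1 0 0 (-1) 0 0 0)
  simp only [h_u, h_v, mul_zero, zero_add] at e1 e2 e3
  have t_x : M 0 1 = 0 := by
    refine (mul_eq_zero_iff_right (mul_ne_zero hg hh)).1 ?_
    linear_combination (1 / 4) * (e3 0 0 0 0 1 0 - e3 0 0 0 0 (-1) 0
      - (e2 0 0 1 0 0 0 - e2 0 0 (-1) 0 0 0) + (e1 0 0 0 1 0 0 - e1 0 0 0 (-1) 0 0))
  have t_y : M 0 2 = 0 := by
    refine (mul_eq_zero_iff_right (mul_ne_zero hg hh)).1 ?_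
    linear_combination (1 / 4) * (e3 0 0 0 0 0 1 - e3 0 0 0 0 0 (-1)
      - (e1 0 1 0 0 0 0 - e1 0 (-1) 0 0 0 0) + (e2 1 0 0 0 0 0 - e2 (-1) 0 0 0 0 0))
  simp only [t_x, t_y, mul_zero] at e1 e2 e3
  -- The a₁-coefficient of the mass equation and the c₁-coefficient of the first momentum equation
  -- both contain ηᵘ_u - ηʰ_h; the weights g and h cancel it. The pair (b₂, c₂) gives `h_eq'`
  -- likewise.
  have h_eq : Z 5 = 2 * h * (M 1 1 - M 0 0) := by
    refine mul_left_cancel₀ hg ?_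
    linear_combination (1 / 2) * g * (e3 1 0 0 0 0 0 - e3 (-1) 0 0 0 0 0)
      + (1 / 2) * h * (e1 0 0 0 0 1 0 - e1 0 0 0 0 (-1) 0)
  have h_eq' : Z 5 = 2 * h * (M 2 2 - M 0 0) := by
    refine mul_left_cancel₀ hg ?_
    linear_combination (1 / 2) * g * (e3 0 0 0 1 0 0 - e3 0 0 0 (-1) 0 0)
      + (1 / 2) * h * (e2 0 0 0 0 0 1 - e2 0 0 0 0 0 (-1))
  have y_y : M 2 2 = M 1 1 := by
    refine mul_left_cancel₀ (mul_ne_zero two_ne_zero hh) ?_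
    linear_combination h_eq - h_eq'
  have y_x : M 2 1 = -M 1 2 := by
    refine mul_left_cancel₀ (mul_ne_zero hg hh) ?_
    linear_combination (-1 / 2) * h * (e1 0 0 0 0 0 1 - e1 0 0 0 0 0 (-1))
      - (1 / 2) * g * (e3 0 0 1 0 0 0 - e3 0 0 (-1) 0 0 0)
  have u_eq : Z 3 = M 1 0 + u * (M 1 1 - M 0 0) + v * M 1 2 := by
    linear_combination (1 / 2) * (e2 0 0 1 0 0 0 - e2 0 0 (-1) 0 0 0)
  have v_eq : Z 4 = M 2 0 - u * M 1 2 + v * (M 1 1 - M 0 0) := by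
    linear_combination (1 / 2) * (e1 0 1 0 0 0 0 - e1 0 (-1) 0 0 0 0) + u * y_x + v * y_y
  exact ⟨t_x, t_y, t_u, t_v, t_h, x_u, x_v, x_h, y_u, y_v, y_h, y_x, y_y, u_eq, v_eq, h_eq,
    by linear_combination e1 0 0 0 0 0 0, by linear_combination e2 0 0 0 0 0 0,
    by linear_combination e3 0 0 0 0 0 0⟩

/-! ### Integration of the determining equations. -/

/-- Nine first-order expressions in the components `Z` and their derivatives `M`. On a point
symmetry they are the coefficients of `X₁, …, X₉`, multiplied by `2 f ^ 2`. -/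
def firstIntegrals {A : Type*} [CommRing A] (f c s x y u v : A) (Z : Fin 6 → A)
    (M : Fin 6 → Fin 6 → A) : Fin 9 → A :=
  let p := 2 * (Z 3 - u * (M 1 1 - M 0 0) - v * M 1 2) - 2 * x * M 3 1 - f * y * M 0 0
  let q := 2 * (Z 4 + u * M 1 2 - v * (M 1 1 - M 0 0)) - 2 * y * M 3 1 + f * x * M 0 0
  ![f * (2 * f * (Z 1 - x * M 1 1 - y * M 1 2) + q),
    f * (2 * f * (Z 2 + x * M 1 2 - y * M 1 1) - p),
    -(f * (s * p + c * q)),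
    f * (c * p - s * q),
    -(2 * f * (f * M 1 2 + M 3 1)),
    f ^ 2 * (2 * M 1 1 - M 0 0),
    2 * f ^ 2 * Z 0 + 4 * M 3 1,
    -(2 * f * s * M 0 0 + 4 * c * M 3 1),
    2 * f * c * M 0 0 - 4 * s * M 3 1]

/-- Here T, X, Y stand for ξᵗ, ξˣ, ξʸ, primes for time derivatives, q for a_t, and w, w₁, w₂ for δt,
δx, δy. The pair P = 2X' - 2xq - fyT', Q = 2Y' - 2yq + fxT' is constant in space and satisfies P_t =
fQ, Q_t = -fP, so rotating it back by the angle ft gives constants. The pair (fT', 2q) rotates in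
the same way, and the other entries balance the equations for T, a, b, X, Y against each other. -/
theorem derivation_coefficients_eq_zero {A : Type*} [CommRing A] [Algebra ℝ A]
    (δ : Derivation ℝ A A) {f c s x y T X Y T' X' Y' a b q w w₁ w₂ : A}
    (df : δ f = 0) (dx : δ x = w₁) (dy : δ y = w₂) (dc : δ c = -(f * s * w))
    (ds : δ s = f * c * w) (dT : δ T = T' * w) (dX : δ X = X' * w + a * w₁ + b * w₂)
    (dY : δ Y = Y' * w - b * w₁ + a * w₂) (dT' : δ T' = 2 * q * w) (da : δ a = q * w)
    (db : 2 * δ b = f * T' * w) (dq : 2 * δ q = -(f * f * T' * w))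
    (dX' : 2 * δ X' = 2 * f * Y' * w + 2 * q * w₁ + f * T' * w₂)
    (dY' : 2 * δ Y' = -(2 * f * X' * w) - f * T' * w₁ + 2 * q * w₂) (k : Fin 9) :
    δ (![f * (2 * f * (X - x * a - y * b) + (2 * Y' - 2 * y * q + f * x * T')),
      f * (2 * f * (Y + x * b - y * a) - (2 * X' - 2 * x * q - f * y * T')),
      -(f * (s * (2 * X' - 2 * x * q - f * y * T') + c * (2 * Y' - 2 * y * q + f * x * T'))),
      f * (c * (2 * X' - 2 * x * q - f * y * T') - s * (2 * Y' - 2 * y * q + f * x * T')),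
      -(2 * f * (f * b + q)),
      f ^ 2 * (2 * a - T'),
      2 * f ^ 2 * T + 4 * q,
      -(2 * f * s * T' + 4 * c * q),
      2 * f * c * T' - 4 * s * q] k) = 0 := by
  have d2 : δ (2 : A) = 0 := δ.map_natCast 2
  have d4 : δ (4 : A) = 0 := δ.map_natCast 4
  fin_cases k <;>
  · simp only [Fin.reduceFinMk, Fin.zero_eta, Fin.mk_one, Matrix.cons_val, map_add, map_sub,
      map_neg, Derivation.leibniz, pow_two, smul_eq_mul, df, dx, dy, dc, ds, d2, d4, dT, dX, dY,
      dT', da]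
    generalize δ b = b' at *
    generalize δ q = q' at *
    generalize δ X' = x' at *
    generalize δ Y' = y' at *
    clear dx dy dc ds dT dX dY dT' da df d2 d4
    grind

theorem derivation_firstIntegrals_eq_zero {A : Type*} [CommRing A] [Algebra ℝ A]
    {d : Fin 6 → Derivation ℝ A A} (hd : ∀ i j a, d i (d j a) = d j (d i a))
    {f g x y u v h c s : A} {Z : Fin 6 → A}
    (hZ : DeterminingSystem f g u v h Z fun k l => d l (Z k))
    (h_reg : ∀ a : A, h * a = 0 → a = 0)
    (df : ∀ l, d l f = 0)
    (dx : ∀ l, d l x = ![0, 1, 0, 0, 0, 0] l) (dy : ∀ l, d l y = ![0, 0, 1, 0, 0, 0] l)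
    (du : ∀ l, d l u = ![0, 0, 0, 1, 0, 0] l) (dv : ∀ l, d l v = ![0, 0, 0, 0, 1, 0] l)
    (dh : ∀ l, d l h = ![0, 0, 0, 0, 0, 1] l)
    (dc : ∀ l, d l c = ![-(f * s), 0, 0, 0, 0, 0] l)
    (ds : ∀ l, d l s = ![f * c, 0, 0, 0, 0, 0] l) (l : Fin 6) (k : Fin 9) :
    d l (firstIntegrals f c s x y u v Z (fun k l => d l (Z k)) k) = 0 := by
  have two_reg : ∀ a : A, 2 * a = 0 → a = 0 := fun a ha => by
    have := congrArg (fun b => (1 / 2 : ℝ) • b) ha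
    simpa [two_mul, ← two_smul ℝ a, smul_smul] using this
  obtain ⟨t_x, t_y, t_u, t_v, t_h, x_u, x_v, x_h, y_u, y_v, y_h, y_x, y_y, u_eq, v_eq, h_eq,
    mom_u, mom_v, mass⟩ := hZ
  beta_reduce at *
  have d2 : ∀ l, d l (2 : A) = 0 := fun l => (d l).map_natCast 2
  have comm_zero {a : A} {i : Fin 6} (j : Fin 6) (ha : d i a = 0) : d i (d j a) = 0 := by
    rw [hd, ha, map_zero]
  have a_y : d 2 (d 1 (Z 1)) = d 1 (d 2 (Z 1)) := hd _ _ _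
  -- With `a_y`, these are the Cauchy–Riemann equations for a and b.
  have b_y : d 2 (d 2 (Z 1)) = -d 1 (d 1 (Z 1)) := by
    rw [← y_y, hd 1 2, y_x, map_neg, neg_neg]
  have xt_x : d 1 (d 0 (Z 1)) = d 0 (d 1 (Z 1)) := hd _ _ _
  have xt_y : d 2 (d 0 (Z 1)) = d 0 (d 2 (Z 1)) := hd _ _ _
  have yt_x : d 1 (d 0 (Z 2)) = -d 0 (d 2 (Z 1)) := by rw [hd, y_x, map_neg]
  have yt_y : d 2 (d 0 (Z 2)) = d 0 (d 1 (Z 1)) := by rw [hd, y_y]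
  simp only [u_eq, v_eq, h_eq, map_add, map_sub, Derivation.leibniz, smul_eq_mul, du, dv, dh, d2,
    xt_x, xt_y, yt_x, yt_y, comm_zero 0 t_x, comm_zero 0 t_y, comm_zero 0 t_u, comm_zero 0 t_v,
    comm_zero 0 x_u, comm_zero 0 x_v, comm_zero 1 x_u, comm_zero 1 x_v, comm_zero 2 x_u,
    comm_zero 2 x_v, comm_zero 0 y_u, comm_zero 0 y_v,
    a_y, b_y, Matrix.cons_val, mul_zero, mul_one, add_zero, zero_add, sub_zero] at mom_u mom_v mass
  -- Once η is eliminated, every term of the mass equation carries a factor h, which `h_reg`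
  -- cancels.
  have mass' : 2 * (2 * d 0 (d 1 (Z 1)) - d 0 (d 0 (Z 0)) + 2 * u * d 1 (d 1 (Z 1))
      + 2 * v * d 1 (d 2 (Z 1))) = 0 :=
    h_reg _ (by linear_combination mass)
  have mass'' := two_reg _ mass'
  -- The derivatives of ξ do not involve u and v, so `mass''` is affine in (u, v); `d 3` and `d 4`
  -- isolate its coefficients.
  have a_x : d 1 (d 1 (Z 1)) = 0 := by
    refine two_reg _ ?_
    have := congrArg (d 3) mass''
    simp only [map_add, map_sub, map_zero, Derivation.leibniz, smul_eq_mul, du, dv, d2] at this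
    simp only [comm_zero _ (comm_zero _ x_u), comm_zero _ (comm_zero _ t_u),
      Matrix.cons_val] at this
    linear_combination this
  have a_y' : d 1 (d 2 (Z 1)) = 0 := by
    refine two_reg _ ?_
    have := congrArg (d 4) mass''
    simp only [map_add, map_sub, map_zero, Derivation.leibniz, smul_eq_mul, du, dv, d2,
      comm_zero _ (comm_zero _ x_v), comm_zero _ (comm_zero _ t_v), Matrix.cons_val] at this
    linear_combination this
  have p_t : d 0 (d 0 (Z 0)) = 2 * d 0 (d 1 (Z 1)) := by
    linear_combination -mass'' + 2 * u * a_x + 2 * v * a_y'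
  have mom_u' :
      d 0 (d 0 (Z 1)) - f * d 0 (Z 2) + v * (2 * d 0 (d 2 (Z 1)) - f * d 0 (Z 0)) = 0 := by
    linear_combination mom_u + u * p_t - (u ^ 2 - v ^ 2 + 2 * g * h) * a_x - 2 * u * v * a_y'
  have b_t : 2 * d 0 (d 2 (Z 1)) = f * d 0 (Z 0) := by
    have := congrArg (d 4) mom_u'
    simp only [map_add, map_sub, map_zero, Derivation.leibniz, smul_eq_mul, dv, d2, df,
      comm_zero _ (comm_zero _ x_v), comm_zero _ y_v, comm_zero _ t_v, Matrix.cons_val] at this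
    linear_combination this
  have x_tt : d 0 (d 0 (Z 1)) = f * d 0 (Z 2) := by linear_combination mom_u' - v * b_t
  have y_tt : d 0 (d 0 (Z 2)) = -(f * d 0 (Z 1)) := by
    linear_combination mom_v + v * p_t + u * b_t - 2 * u * v * a_x
      - (-u ^ 2 + v ^ 2 + 2 * g * h) * a_y'
  have a_tt : 2 * d 0 (d 0 (d 1 (Z 1))) = -(f * (f * d 0 (Z 0))) := by
    have := congrArg (d 1) x_tt
    simp only [Derivation.leibniz, smul_eq_mul, df, yt_x] at this
    rw [hd, xt_x] at this
    linear_combination 2 * this - f * b_t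
  have u_x : d 1 (Z 3) = d 0 (d 1 (Z 1)) := by
    simp only [u_eq, map_add, map_sub, Derivation.leibniz, smul_eq_mul, du, dv, xt_x,
      comm_zero 0 t_x, a_x, a_y', Matrix.cons_val]
    ring
  have b_y' : d 2 (d 2 (Z 1)) = 0 := by rw [b_y, a_x, neg_zero]
  have a_yy : d 2 (d 1 (Z 1)) = 0 := by rw [a_y, a_y']
  have xt_eq : Z 3 - u * (d 1 (Z 1) - d 0 (Z 0)) - v * d 2 (Z 1) = d 0 (Z 1) := by
    linear_combination u_eq
  have yt_eq : Z 4 + u * d 2 (Z 1) - v * (d 1 (Z 1) - d 0 (Z 0)) = d 0 (Z 2) := by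
    linear_combination v_eq
  simp only [firstIntegrals, xt_eq, yt_eq, u_x]
  -- `w` is the time component of the direction `l`; `dx l` and `dy l` determine `w₁` and `w₂`.
  refine derivation_coefficients_eq_zero (w := ![1, 0, 0, 0, 0, 0] l) (d l) (df l) (dx l) (dy l)
    ?_ ?_ ?_ ?_ ?_ ?_ ?_ ?_ ?_ ?_ ?_ k <;> fin_cases l <;>
    simp only [Fin.reduceFinMk, Fin.zero_eta, Fin.mk_one, Matrix.cons_val, mul_one, mul_zero,
      add_zero, zero_add, sub_zero, zero_sub, neg_zero, dc, ds, t_x, t_y, t_u, t_v, t_h, x_u, x_v,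
      x_h, y_x, y_y, y_u, y_v, y_h, p_t, a_x, a_y', a_yy, b_y', b_t, x_tt, y_tt, a_tt, xt_x, xt_y,
      yt_x, yt_y, comm_zero _ t_x, comm_zero _ t_y, comm_zero _ t_u, comm_zero _ t_v,
      comm_zero _ t_h, comm_zero _ x_u, comm_zero _ x_v, comm_zero _ x_h, comm_zero _ y_u,
      comm_zero _ y_v, comm_zero _ y_h, comm_zero _ a_x, comm_zero _ a_yy,
      comm_zero _ (comm_zero _ x_u), comm_zero _ (comm_zero _ x_v), comm_zero _ (comm_zero _ x_h)]
  all_goals first | ring1 | linear_combination b_t | linear_combination -b_t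

/-! ### Coordinates and derivatives of vector fields -/

/-- The coordinates `(t, x, y, u, v, h)` of a point. -/
def coords (b : BaseSpace) : Fin 6 → ℝ := ![b.1 0, b.1 1, b.1 2, b.2 0, b.2 1, b.2 2]

/-- The coordinate vectors in the order `(t, x, y, u, v, h)`. -/
def coordVec : Fin 6 → BaseSpace :=
  ![(![1, 0, 0], 0), (![0, 1, 0], 0), (![0, 0, 1], 0),
    (0, ![1, 0, 0]), (0, ![0, 1, 0]), (0, ![0, 0, 1])]

theorem coords_injective : Function.Injective coords := fun b b' h => by
  have e := fun k => congrFun h k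
  simp only [coords, Fin.forall_fin_succ] at e
  ext i <;> fin_cases i <;> simp_all

theorem coords_coordVec (l : Fin 6) : coords (coordVec l) = Pi.single l 1 := by
  ext k
  fin_cases l <;> fin_cases k <;> simp [coords, coordVec]

theorem eq_sum_coordVec (b : BaseSpace) : b = ∑ l, coords b l • coordVec l := by
  ext i <;> fin_cases i <;> simp [coords, coordVec, Fin.sum_univ_succ]

/-- The matrix of a linear map of `BaseSpace` in the coordinates `(t, x, y, u, v, h)`. -/
def jacobian (D : BaseSpace →L[ℝ] BaseSpace) (k l : Fin 6) : ℝ := coords (D (coordVec l)) k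

theorem fderiv_base_fst (i : Fin 3) (b : BaseSpace) :
    fderiv ℝ (fun b : BaseSpace => b.1 i) b
      = (ContinuousLinearMap.proj i).comp (ContinuousLinearMap.fst ℝ _ _) :=
  ((ContinuousLinearMap.proj i).comp
    (ContinuousLinearMap.fst ℝ (Fin 3 → ℝ) (Fin 3 → ℝ))).hasFDerivAt.fderiv

theorem fderiv_base_snd (i : Fin 3) (b : BaseSpace) :
    fderiv ℝ (fun b : BaseSpace => b.2 i) b
      = (ContinuousLinearMap.proj i).comp (ContinuousLinearMap.snd ℝ _ _) :=
  ((ContinuousLinearMap.proj i).comp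
    (ContinuousLinearMap.snd ℝ (Fin 3 → ℝ) (Fin 3 → ℝ))).hasFDerivAt.fderiv

theorem fderiv_jet_base (j : Fin 3) (z w : JetSpace) :
    fderiv ℝ (fun z : JetSpace => z.1.2 j) z w = w.1.2 j := by
  have := ((ContinuousLinearMap.proj j).comp ((ContinuousLinearMap.snd ℝ (Fin 3 → ℝ)
    (Fin 3 → ℝ)).comp (ContinuousLinearMap.fst ℝ BaseSpace
      (Fin 3 → Fin 3 → ℝ)))).hasFDerivAt (x := z)
  exact congrArg (fun D => D w) this.fderiv

theorem fderiv_jet_snd (j i : Fin 3) (z w : JetSpace) :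
    fderiv ℝ (fun z : JetSpace => z.2 j i) z w = w.2 j i := by
  have := ((ContinuousLinearMap.proj (R := ℝ) (φ := fun _ : Fin 3 => ℝ) i).comp
    ((ContinuousLinearMap.proj (R := ℝ) (φ := fun _ : Fin 3 => Fin 3 → ℝ) j).comp
      (ContinuousLinearMap.snd ℝ BaseSpace (Fin 3 → Fin 3 → ℝ)))).hasFDerivAt (x := z)
  exact congrArg (fun D => D w) this.fderiv

theorem fderiv_equations (f g : ℝ) (z w : JetSpace) :
    fderiv ℝ (equations f g) z w
      = ![w.2 0 0 + (w.1.2 0 * z.2 0 1 + z.1.2 0 * w.2 0 1)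
            + (w.1.2 1 * z.2 0 2 + z.1.2 1 * w.2 0 2) - f * w.1.2 1 + g * w.2 2 1,
          w.2 1 0 + (w.1.2 0 * z.2 1 1 + z.1.2 0 * w.2 1 1)
            + (w.1.2 1 * z.2 1 2 + z.1.2 1 * w.2 1 2) + f * w.1.2 0 + g * w.2 2 2,
          w.2 2 0 + (w.2 0 1 * z.1.2 2 + z.2 0 1 * w.1.2 2
              + (w.1.2 0 * z.2 2 1 + z.1.2 0 * w.2 2 1))
            + (w.2 1 2 * z.1.2 2 + z.2 1 2 * w.1.2 2
              + (w.1.2 1 * z.2 2 2 + z.1.2 1 * w.2 2 2))] := by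
  have hdiff : ∀ j, DifferentiableAt ℝ (fun z => equations f g z j) z := fun j => by
    fin_cases j <;>
      simp only [equations, Fin.reduceFinMk, Fin.zero_eta, Fin.mk_one, Matrix.cons_val] <;>
      fun_prop
  rw [fderiv_pi (φ := fun j z => equations f g z j) hdiff]
  ext j
  rw [ContinuousLinearMap.pi_apply]
  fin_cases j <;>
  · simp only [equations, Fin.reduceFinMk, Fin.zero_eta, Fin.mk_one, Matrix.cons_val]
    simp (disch := fun_prop) only [fderiv_fun_add, fderiv_fun_sub, fderiv_fun_mul,
      fderiv_fun_const, add_apply, sub_apply, smul_apply, Pi.zero_apply, zero_apply,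
      fderiv_jet_base, fderiv_jet_snd, smul_eq_mul]
    ring

theorem totalDeriv_fst {X : BaseSpace → BaseSpace} {z : JetSpace}
    (hX : DifferentiableAt ℝ X z.1) (i l : Fin 3) :
    totalDeriv i (fun b => (X b).1 l) z
      = (fderiv ℝ X z.1 (Pi.single i 1, fun k => z.2 k i)).1 l := by
  have := ((ContinuousLinearMap.proj l).comp (ContinuousLinearMap.fst ℝ (Fin 3 → ℝ)
    (Fin 3 → ℝ))).hasFDerivAt.comp z.1 hX.hasFDerivAt
  exact congrArg (fun D => D (Pi.single i 1, fun k => z.2 k i)) this.fderiv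

theorem totalDeriv_snd {X : BaseSpace → BaseSpace} {z : JetSpace}
    (hX : DifferentiableAt ℝ X z.1) (i l : Fin 3) :
    totalDeriv i (fun b => (X b).2 l) z
      = (fderiv ℝ X z.1 (Pi.single i 1, fun k => z.2 k i)).2 l := by
  have := ((ContinuousLinearMap.proj l).comp (ContinuousLinearMap.snd ℝ (Fin 3 → ℝ)
    (Fin 3 → ℝ))).hasFDerivAt.comp z.1 hX.hasFDerivAt
  exact congrArg (fun D => D (Pi.single i 1, fun k => z.2 k i)) this.fderiv

theorem apply_single_jet (D : BaseSpace →L[ℝ] BaseSpace) (i : Fin 3) (p : Fin 3 → Fin 3 → ℝ)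
    (k : Fin 6) :
    coords (D (Pi.single i 1, fun j => p j i)) k = jacobian D k (Fin.castAdd 3 i)
      + (p 0 i * jacobian D k 3 + p 1 i * jacobian D k 4 + p 2 i * jacobian D k 5) := by
  have : ((Pi.single i 1, fun j => p j i) : BaseSpace) = coordVec (Fin.castAdd 3 i)
      + (p 0 i • coordVec 3 + p 1 i • coordVec 4 + p 2 i • coordVec 5) := by
    ext l <;> fin_cases i <;> fin_cases l <;> simp [coordVec]
  rw [this]
  simp only [map_add, map_smul, jacobian]
  fin_cases k <;> simp [coords]

/-- The condition sees X only through its value and Jacobian at the base point, linearly in both. -/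
theorem fderiv_equations_prolong (f g : ℝ) {X : BaseSpace → BaseSpace} {z : JetSpace}
    (hX : DifferentiableAt ℝ X z.1) :
    fderiv ℝ (equations f g) z (prolong X z)
      = linearizedEquations f g (z.1.2 0) (z.1.2 1) (z.1.2 2) (coords (X z.1))
          (jacobian (fderiv ℝ X z.1)) z.2 := by
  rw [fderiv_equations]
  simp only [prolong, totalDeriv_fst hX, totalDeriv_snd hX, Fin.sum_univ_three,
    linearizedEquations, ← apply_single_jet]
  rfl

/-! ### The vector fields `X₁, …, X₉` -/

/-- The derivative of `generator f k` at `b` in the direction `w`. -/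
def generatorDeriv (f : ℝ) (k : Fin 9) (b w : BaseSpace) : BaseSpace :=
  let x := b.1 1
  let y := b.1 2
  let u := b.2 0
  let v := b.2 1
  let h := b.2 2
  let c := Real.cos (f * b.1 0)
  let s := Real.sin (f * b.1 0)
  let dx := w.1 1
  let dy := w.1 2
  let du := w.2 0
  let dv := w.2 1
  let dh := w.2 2
  let dc := -(f * s * w.1 0)
  let ds := f * c * w.1 0
  (![0, 0, (![0, dc, -ds], ![-(f * ds), -(f * dc), 0]),
     (![0, ds, dc], ![f * dc, -(f * ds), 0]),
     (![0, -dy, dx], ![-dv, du, 0]),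
     (![0, dx, dy], ![du, dv, 2 * dh]),
     0,
     (![dc, -(f / 2 * (dx * s + x * ds - (dy * c + y * dc))),
        -(f / 2 * (dx * c + x * dc + (dy * s + y * ds)))],
      ![f / 2 * ((du - f * dy) * s + (u - f * y) * ds + ((dv - f * dx) * c + (v - f * x) * dc)),
        -(f / 2 * ((du + f * dy) * c + (u + f * y) * dc - ((dv + f * dx) * s + (v + f * x) * ds))),
        f * (dh * s + h * ds)]),
     (![ds, f / 2 * (dx * c + x * dc + (dy * s + y * ds)),
        -(f / 2 * (dx * s + x * ds - (dy * c + y * dc)))],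
      ![-(f / 2 * ((du - f * dy) * c + (u - f * y) * dc - ((dv - f * dx) * s + (v - f * x) * ds))),
        -(f / 2 * ((du + f * dy) * s + (u + f * y) * ds + ((dv + f * dx) * c + (v + f * x) * dc))),
        -(f * (dh * c + h * dc))])] : Fin 9 → BaseSpace) k

theorem differentiableAt_generator (f : ℝ) (k : Fin 9) (b : BaseSpace) :
    DifferentiableAt ℝ (generator f k) b :=
  (contDiff_generator f k).differentiable (by simp) b

theorem fderiv_fst_apply {X : BaseSpace → BaseSpace} {b : BaseSpace}
    (hX : DifferentiableAt ℝ X b) (w : BaseSpace) (i : Fin 3) :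
    (fderiv ℝ X b w).1 i = fderiv ℝ (fun b => (X b).1 i) b w := by
  have := ((ContinuousLinearMap.proj i).comp (ContinuousLinearMap.fst ℝ (Fin 3 → ℝ)
    (Fin 3 → ℝ))).hasFDerivAt.comp b hX.hasFDerivAt
  exact (congrArg (fun D => D w) this.fderiv).symm

theorem fderiv_snd_apply {X : BaseSpace → BaseSpace} {b : BaseSpace}
    (hX : DifferentiableAt ℝ X b) (w : BaseSpace) (i : Fin 3) :
    (fderiv ℝ X b w).2 i = fderiv ℝ (fun b => (X b).2 i) b w := by
  have := ((ContinuousLinearMap.proj i).comp (ContinuousLinearMap.snd ℝ (Fin 3 → ℝ)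
    (Fin 3 → ℝ))).hasFDerivAt.comp b hX.hasFDerivAt
  exact (congrArg (fun D => D w) this.fderiv).symm

theorem fderiv_generator_fst (f : ℝ) (k : Fin 9) (b w : BaseSpace) (i : Fin 3) :
    (fderiv ℝ (generator f k) b w).1 i = (generatorDeriv f k b w).1 i := by
  rw [fderiv_fst_apply (differentiableAt_generator f k b)]
  fin_cases k <;> fin_cases i <;>
  · simp (disch := fun_prop) [generator, generatorDeriv, fderiv_fun_add, fderiv_fun_sub,
      fderiv_fun_mul, fderiv_cos, fderiv_sin, fderiv_base_fst,
      -mul_eq_mul_left_iff, -mul_eq_mul_right_iff, -mul_eq_zero]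
    try ring

set_option maxHeartbeats 1000000 in
theorem fderiv_generator_snd (f : ℝ) (k : Fin 9) (b w : BaseSpace) (i : Fin 3) :
    (fderiv ℝ (generator f k) b w).2 i = (generatorDeriv f k b w).2 i := by
  rw [fderiv_snd_apply (differentiableAt_generator f k b)]
  fin_cases k <;> fin_cases i <;>
  · simp (disch := fun_prop) [generator, generatorDeriv, fderiv_fun_add, fderiv_fun_sub,
      fderiv_fun_mul, fderiv_cos, fderiv_sin, fderiv_base_fst, fderiv_base_snd,
      -mul_eq_mul_left_iff, -mul_eq_mul_right_iff, -mul_eq_zero]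
    try ring

theorem fderiv_generator (f : ℝ) (k : Fin 9) (b w : BaseSpace) :
    fderiv ℝ (generator f k) b w = generatorDeriv f k b w :=
  Prod.ext (funext fun i => fderiv_generator_fst f k b w i)
    (funext fun i => fderiv_generator_snd f k b w i)

/-! ### Brackets of the generators, and duality with the first integrals. -/

/-- The table of Lie brackets of `X₁, …, X₉`, in terms of the family `G` of these elements. -/
def bracketTable {V : Type*} [AddCommGroup V] [Module ℝ V] (f : ℝ) (G : Fin 9 → V) :
    Fin 9 → Fin 9 → V :=
  ![![0, 0, 0, 0, G 1, G 0, 0, -(f / 2) • G 3, (f / 2) • G 2],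
    ![0, 0, 0, 0, -G 0, G 1, 0, (f / 2) • G 2, (f / 2) • G 3],
    ![0, 0, 0, 0, G 3, G 2, f • G 3, (f / 2) • G 1, (f / 2) • G 0],
    ![0, 0, 0, 0, -G 2, G 3, -f • G 2, -(f / 2) • G 0, (f / 2) • G 1],
    ![-G 1, G 0, -G 3, G 2, 0, 0, 0, 0, 0],
    ![-G 0, -G 1, -G 2, -G 3, 0, 0, 0, 0, 0],
    ![0, 0, -f • G 3, f • G 2, 0, 0, 0, -f • G 8, f • G 7],
    ![(f / 2) • G 3, -(f / 2) • G 2, -(f / 2) • G 1, (f / 2) • G 0, 0, 0, f • G 8, 0,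
      f • G 6 - (f ^ 2 / 2) • G 4],
    ![-(f / 2) • G 2, -(f / 2) • G 3, -(f / 2) • G 0, -(f / 2) • G 1, 0, 0, -f • G 7,
      (f ^ 2 / 2) • G 4 - f • G 6, 0]]

theorem bracketTable_mem_span {V : Type*} [AddCommGroup V] [Module ℝ V] (f : ℝ) (G : Fin 9 → V)
    (i j : Fin 9) : bracketTable f G i j ∈ Submodule.span ℝ (Set.range G) := by
  have hG : ∀ k, G k ∈ Submodule.span ℝ (Set.range G) := fun k =>
    Submodule.subset_span ⟨k, rfl⟩
  have hs : ∀ (r : ℝ) k, r • G k ∈ Submodule.span ℝ (Set.range G) := fun r k =>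
    Submodule.smul_mem _ r (hG k)
  fin_cases i <;> fin_cases j <;>
    simp only [bracketTable, Fin.reduceFinMk, Fin.zero_eta, Fin.mk_one, Matrix.cons_val] <;>
    first
    | exact Submodule.zero_mem _
    | exact hG _
    | exact Submodule.neg_mem _ (hG _)
    | exact hs _ _
    | exact Submodule.sub_mem _ (hs _ _) (hs _ _)

set_option maxHeartbeats 2000000 in
theorem lieBracket_generator (f : ℝ) (i j : Fin 9) (b : BaseSpace) :
    VectorField.lieBracket ℝ (generator f i) (generator f j) b
      = bracketTable f (fun k => generator f k b) i j := by
  have hcs := Real.sin_sq_add_cos_sq (f * b.1 0)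
  rw [VectorField.lieBracket, fderiv_generator, fderiv_generator]
  refine coords_injective (funext fun k => ?_)
  fin_cases i <;> fin_cases j <;>
  · simp only [bracketTable, generator, generatorDeriv, Fin.reduceFinMk, Fin.zero_eta, Fin.mk_one,
      Matrix.cons_val]
    generalize Real.sin (f * b.1 0) = s at *
    generalize Real.cos (f * b.1 0) = c at *
    fin_cases k <;>
    · simp only [coords, Fin.reduceFinMk, Fin.zero_eta, Fin.mk_one, Matrix.cons_val,
        Prod.fst_sub, Prod.snd_sub, Prod.fst_zero, Prod.snd_zero, Prod.smul_fst, Prod.smul_snd, Prod.fst_neg, Prod.snd_neg,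
        Pi.sub_apply, Pi.zero_apply, Pi.smul_apply, Pi.neg_apply, smul_eq_mul]
      first | ring1 | grind

/-- The values of `firstIntegrals` on `X₁, …, X₉`. -/
theorem firstIntegrals_generator (f : ℝ) (j k : Fin 9) (b : BaseSpace) :
    firstIntegrals f (Real.cos (f * b.1 0)) (Real.sin (f * b.1 0)) (b.1 1) (b.1 2) (b.2 0) (b.2 1)
      (coords (generator f j b)) (jacobian (fderiv ℝ (generator f j) b)) k
      = if j = k then 2 * f ^ 2 else 0 := by
  have hcs := Real.sin_sq_add_cos_sq (f * b.1 0)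
  fin_cases j <;> fin_cases k <;>
  · simp only [firstIntegrals, jacobian, fderiv_generator, generator, generatorDeriv,
      coordVec, coords, Fin.reduceFinMk, Fin.zero_eta, Fin.mk_one, Matrix.cons_val, Fin.reduceEq,
      Prod.fst_zero, Prod.snd_zero, Pi.zero_apply, if_true, if_false]
    generalize Real.sin (f * b.1 0) = s at *
    generalize Real.cos (f * b.1 0) = c at *
    first | ring1 | grind

theorem linearizedEquations_generator (f g : ℝ) (k : Fin 9) (b : BaseSpace)
    (p : Fin 3 → Fin 3 → ℝ) (hp : equations f g (b, p) = 0) :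
    linearizedEquations f g (b.2 0) (b.2 1) (b.2 2) (coords (generator f k b))
      (jacobian (fderiv ℝ (generator f k) b)) p = 0 := by
  have e0 := congrFun hp 0
  have e1 := congrFun hp 1
  have e2 := congrFun hp 2
  simp only [equations, Matrix.cons_val, Pi.zero_apply] at e0 e1 e2
  have p0 : p 0 0 = -(b.2 0 * p 0 1 + b.2 1 * p 0 2 - f * b.2 1 + g * p 2 1) := by
    linear_combination e0
  have p1 : p 1 0 = -(b.2 0 * p 1 1 + b.2 1 * p 1 2 + f * b.2 0 + g * p 2 2) := by
    linear_combination e1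
  have p2 : p 2 0 = -((p 0 1 * b.2 2 + b.2 0 * p 2 1) + (p 1 2 * b.2 2 + b.2 1 * p 2 2)) := by
    linear_combination e2
  have i3 : Fin.natAdd 3 (0 : Fin 3) = (3 : Fin 6) := rfl
  have i4 : Fin.natAdd 3 (1 : Fin 3) = (4 : Fin 6) := rfl
  have i5 : Fin.natAdd 3 (2 : Fin 3) = (5 : Fin 6) := rfl
  have j0 : Fin.castAdd 3 (0 : Fin 3) = (0 : Fin 6) := rfl
  have j1 : Fin.castAdd 3 (1 : Fin 3) = (1 : Fin 6) := rfl
  have j2 : Fin.castAdd 3 (2 : Fin 3) = (2 : Fin 6) := rfl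
  ext i
  fin_cases k <;>
  · simp only [linearizedEquations, i3, i4, i5, j0, j1, j2, jacobian, fderiv_generator, generator,
      generatorDeriv, coordVec, coords, Fin.reduceFinMk, Fin.zero_eta, Fin.mk_one,
      Matrix.cons_val, Prod.fst_zero, Prod.snd_zero, Pi.zero_apply, p0, p1, p2]
    fin_cases i <;>
    · simp only [Fin.reduceFinMk, Fin.zero_eta, Fin.mk_one, Matrix.cons_val]
      ring1

/-- The components of a solution of the determining equations, in terms of its first integrals. -/
theorem eq_sum_firstIntegrals {f g : ℝ} (b : BaseSpace) {Z : Fin 6 → ℝ} {M : Fin 6 → Fin 6 → ℝ}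
    (hZ : DeterminingSystem f g (b.2 0) (b.2 1) (b.2 2) Z M) (k : Fin 6) :
    2 * f ^ 2 * Z k = ∑ j, firstIntegrals f (Real.cos (f * b.1 0)) (Real.sin (f * b.1 0))
      (b.1 1) (b.1 2) (b.2 0) (b.2 1) Z M j * coords (generator f j b) k := by
  have hcs := Real.sin_sq_add_cos_sq (f * b.1 0)
  -- Only the ηʰ component needs a determining equation; for the other five the formula is a
  -- trigonometric identity in arbitrary `Z` and `M`.
  have := hZ.h_eq
  fin_cases k <;>
  · simp only [firstIntegrals, generator, coords, Fin.reduceFinMk, Fin.zero_eta, Fin.mk_one,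
      Matrix.cons_val, Fin.sum_univ_succ, Fin.succ_zero_eq_one, Fin.succ_one_eq_two, Fin.reduceSucc,
      Finset.univ_eq_empty, Finset.sum_empty]
    generalize Real.sin (f * b.1 0) = s at *
    generalize Real.cos (f * b.1 0) = c at *
    grind

/-! ### Point symmetries in coordinates -/

theorem coords_add (b b' : BaseSpace) : coords (b + b') = coords b + coords b' := by
  ext k
  fin_cases k <;> rfl

theorem coords_smul (r : ℝ) (b : BaseSpace) : coords (r • b) = r • coords b := by
  ext k
  fin_cases k <;> rfl

theorem jacobian_add (D D' : BaseSpace →L[ℝ] BaseSpace) :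
    jacobian (D + D') = jacobian D + jacobian D' := by
  ext k l
  simp [jacobian, coords_add]

theorem jacobian_smul (r : ℝ) (D : BaseSpace →L[ℝ] BaseSpace) :
    jacobian (r • D) = r • jacobian D := by
  ext k l
  simp [jacobian, coords_smul]

theorem linearizedEquations_add (f g u v h : ℝ) (Z Z' : Fin 6 → ℝ) (M M' : Fin 6 → Fin 6 → ℝ)
    (p : Fin 3 → Fin 3 → ℝ) :
    linearizedEquations f g u v h (Z + Z') (M + M') p
      = linearizedEquations f g u v h Z M p + linearizedEquations f g u v h Z' M' p := by
  ext i
  fin_cases i <;> simp only [linearizedEquations, Fin.reduceFinMk, Fin.zero_eta, Fin.mk_one,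
    Matrix.cons_val, Pi.add_apply] <;> ring

theorem linearizedEquations_smul (f g u v h r : ℝ) (Z : Fin 6 → ℝ) (M : Fin 6 → Fin 6 → ℝ)
    (p : Fin 3 → Fin 3 → ℝ) :
    linearizedEquations f g u v h (r • Z) (r • M) p
      = r • linearizedEquations f g u v h Z M p := by
  ext i
  fin_cases i <;> simp only [linearizedEquations, Fin.reduceFinMk, Fin.zero_eta, Fin.mk_one,
    Matrix.cons_val, Pi.smul_apply, smul_eq_mul] <;> ring

theorem firstIntegrals_add (f c s x y u v : ℝ) (Z Z' : Fin 6 → ℝ) (M M' : Fin 6 → Fin 6 → ℝ) :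
    firstIntegrals f c s x y u v (Z + Z') (M + M')
      = firstIntegrals f c s x y u v Z M + firstIntegrals f c s x y u v Z' M' := by
  ext i
  fin_cases i <;> simp only [firstIntegrals, Fin.reduceFinMk, Fin.zero_eta, Fin.mk_one,
    Matrix.cons_val, Pi.add_apply] <;> ring

theorem firstIntegrals_smul (f c s x y u v r : ℝ) (Z : Fin 6 → ℝ) (M : Fin 6 → Fin 6 → ℝ) :
    firstIntegrals f c s x y u v (r • Z) (r • M) = r • firstIntegrals f c s x y u v Z M := by
  ext i
  fin_cases i <;> simp only [firstIntegrals, Fin.reduceFinMk, Fin.zero_eta, Fin.mk_one,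
    Matrix.cons_val, Pi.smul_apply, smul_eq_mul] <;> ring

variable {W : TopologicalSpace.Opens BaseSpace}

theorem fderiv_add_field (X Y : SmoothVectorField W) {b : BaseSpace} (hb : b ∈ W) :
    fderiv ℝ (X + Y : SmoothVectorField W) b = fderiv ℝ X b + fderiv ℝ Y b :=
  fderiv_add (X.differentiableAt hb) (Y.differentiableAt hb)

theorem fderiv_smul_field (r : ℝ) (X : SmoothVectorField W) {b : BaseSpace} (hb : b ∈ W) :
    fderiv ℝ (r • X : SmoothVectorField W) b = r • fderiv ℝ X b :=
  fderiv_const_smul (X.differentiableAt hb) r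

theorem generatorOn_apply (f : ℝ) (k : Fin 9) {b : BaseSpace} (hb : b ∈ W) :
    generatorOn f W k b = generator f k b :=
  SmoothVectorField.restrict_apply _ _ hb

theorem generatorOn_eventuallyEq (f : ℝ) (k : Fin 9) {b : BaseSpace} (hb : b ∈ W) :
    (generatorOn f W k).toFun =ᶠ[nhds b] generator f k := by
  filter_upwards [W.isOpen.mem_nhds hb] with c hc using generatorOn_apply f k hc

theorem isPointSymmetry_iff {f g : ℝ} {X : SmoothVectorField W} :
    IsPointSymmetry (equations f g) X ↔ ∀ b ∈ W, ∀ p, equations f g (b, p) = 0 →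
      linearizedEquations f g (b.2 0) (b.2 1) (b.2 2) (coords (X b))
        (jacobian (fderiv ℝ X b)) p = 0 := by
  constructor
  · intro h b hb p hp
    rw [← h (b, p) hb hp]
    exact (fderiv_equations_prolong f g (z := (b, p)) (X.differentiableAt hb)).symm
  · intro h z hz hF
    rw [fderiv_equations_prolong f g (X.differentiableAt hz)]
    exact h z.1 hz z.2 hF

theorem isPointSymmetry_of_mem_span {f g : ℝ} {X : SmoothVectorField W}
    (hX : X ∈ Submodule.span ℝ (Set.range (generatorOn f W))) :
    IsPointSymmetry (equations f g) X := by
  rw [isPointSymmetry_iff]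
  intro b hb p hp
  induction hX using Submodule.span_induction with
  | mem X hX =>
    obtain ⟨k, rfl⟩ := hX
    rw [generatorOn_apply f k hb, (generatorOn_eventuallyEq f k hb).fderiv_eq]
    exact linearizedEquations_generator f g k b p hp
  | zero =>
    -- Homogeneity with factor 0 gives the vanishing at zero data.
    have := linearizedEquations_smul f g (b.2 0) (b.2 1) (b.2 2) 0 0 0 p
    rw [zero_smul, zero_smul, zero_smul] at this
    convert this using 2
    · ext k; fin_cases k <;> rfl
    · have h0 : fderiv ℝ (0 : SmoothVectorField W) b = 0 :=
        (hasFDerivAt_const (0 : BaseSpace) b).fderiv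
      rw [h0]
      ext k l; fin_cases k <;> rfl
  | add X Y _ _ hX hY =>
    rw [SmoothVectorField.add_apply, fderiv_add_field X Y hb, coords_add, jacobian_add,
      linearizedEquations_add, hX, hY, add_zero]
  | smul r X _ hX =>
    rw [SmoothVectorField.smul_apply, fderiv_smul_field r X hb, coords_smul, jacobian_smul,
      linearizedEquations_smul, hX, smul_zero]

/-! ### Closure under the bracket and linear independence. -/

theorem lie_generatorOn (f : ℝ) (i j : Fin 9) :
    ⁅generatorOn f W i, generatorOn f W j⁆ = bracketTable f (generatorOn f W) i j := by
  refine SmoothVectorField.ext_on fun b hb => ?_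
  rw [SmoothVectorField.bracket_apply _ _ hb,
    (generatorOn_eventuallyEq f i hb).lieBracket_vectorField_eq (generatorOn_eventuallyEq f j hb),
    lieBracket_generator]
  have : (fun k => generator f k b) = fun k => generatorOn f W k b :=
    funext fun k => (generatorOn_apply f k hb).symm
  rw [this]
  fin_cases i <;> fin_cases j <;> rfl

theorem lie_mem_span {f : ℝ} {X Y : SmoothVectorField W}
    (hX : X ∈ Submodule.span ℝ (Set.range (generatorOn f W)))
    (hY : Y ∈ Submodule.span ℝ (Set.range (generatorOn f W))) :
    ⁅X, Y⁆ ∈ Submodule.span ℝ (Set.range (generatorOn f W)) := by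
  induction hX, hY using Submodule.span_induction₂ with
  | mem_mem X Y hX hY =>
    obtain ⟨i, rfl⟩ := hX
    obtain ⟨j, rfl⟩ := hY
    rw [lie_generatorOn]
    exact bracketTable_mem_span f _ i j
  | zero_left => simp
  | zero_right => simp
  | add_left X X' Y _ _ _ h h' => rw [add_lie]; exact add_mem h h'
  | add_right X Y Y' _ _ _ h h' => rw [lie_add]; exact add_mem h h'
  | smul_left r X Y _ _ h => rw [smul_lie]; exact Submodule.smul_mem _ r h
  | smul_right r X Y _ _ h => rw [lie_smul]; exact Submodule.smul_mem _ r h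

/-- The first integrals at a point, as a linear map. -/
def firstIntegralsAt (f : ℝ) (b : W) : SmoothVectorField W →ₗ[ℝ] Fin 9 → ℝ where
  toFun X := firstIntegrals f (Real.cos (f * b.1.1 0)) (Real.sin (f * b.1.1 0)) (b.1.1 1)
    (b.1.1 2) (b.1.2 0) (b.1.2 1) (coords (X b)) (jacobian (fderiv ℝ X b))
  map_add' X Y := by
    rw [SmoothVectorField.add_apply, fderiv_add_field X Y b.2, coords_add, jacobian_add,
      firstIntegrals_add]
  map_smul' r X := by
    rw [SmoothVectorField.smul_apply, fderiv_smul_field r X b.2, coords_smul, jacobian_smul,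
      firstIntegrals_smul]
    rfl

theorem firstIntegralsAt_generatorOn (f : ℝ) (b : W) (j k : Fin 9) :
    firstIntegralsAt f b (generatorOn f W j) k = if j = k then 2 * f ^ 2 else 0 := by
  rw [← firstIntegrals_generator f j k b]
  change firstIntegrals _ _ _ _ _ _ _ _ _ _ = _
  rw [generatorOn_apply f j b.2, (generatorOn_eventuallyEq f j b.2).fderiv_eq]

/-- At a single point the first integrals send the generators to 2f² times the standard basis of ℝ⁹.
-/
theorem linearIndependent_generatorOn {f : ℝ} (hf : f ≠ 0) (hW : (W : Set BaseSpace).Nonempty) :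
    LinearIndependent ℝ (generatorOn f W) := by
  obtain ⟨b, hb⟩ := hW
  rw [Fintype.linearIndependent_iff]
  intro a ha k
  have := congrFun (congrArg (firstIntegralsAt f ⟨b, hb⟩) ha) k
  simpa [firstIntegralsAt_generatorOn, hf] using this

/-! ### Every point symmetry is a combination of `X₁, …, X₉` -/

open smoothFunctions

/-- The set h ≠ 0 is dense because h is an open map. This lets W meet h = 0, where division by h is
impossible. -/
theorem smoothFunctions_ext_of_ne {φ ψ : smoothFunctions W}
    (h : ∀ b : W, b.1.2 2 ≠ 0 → φ.1 b = ψ.1 b) : φ = ψ := by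
  rw [← sub_eq_zero]
  refine eq_zero_of_forall_frequently _ fun b => ?_
  have hd : Dense {c : BaseSpace | c.2 2 ≠ 0} :=
    (dense_compl_singleton (0 : ℝ)).preimage ((isOpenMap_eval (2 : Fin 3)).comp isOpenMap_snd)
  refine ((mem_closure_iff_frequently.1 (hd b)).and_eventually
    (W.isOpen.mem_nhds b.2)).mono fun c hc => ?_
  rw [extendZero_apply _ ⟨c, hc.2⟩]
  exact sub_eq_zero.2 (h ⟨c, hc.2⟩ hc.1)

variable (W) in
/-- The coordinates `(t, x, y, u, v, h)` as smooth functions on `W`. -/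
def coordFun (k : Fin 6) : smoothFunctions W :=
  ofContDiffAt (fun b => coords b k) fun b => by
    fin_cases k <;> simp only [coords, Fin.reduceFinMk, Fin.zero_eta, Fin.mk_one,
      Matrix.cons_val] <;> fun_prop

/-- The components of a vector field as smooth functions. -/
def component (X : SmoothVectorField W) (k : Fin 6) : smoothFunctions W :=
  ofContDiffAt (fun b => coords (X b) k) fun b => by
    have := X.contDiffAt b.2
    fin_cases k <;> simp only [coords, Fin.reduceFinMk, Fin.zero_eta, Fin.mk_one,
      Matrix.cons_val] <;> fun_prop

theorem dirDeriv_component (X : SmoothVectorField W) (k l : Fin 6) (b : W) :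
    (dirDeriv (coordVec l) (component X k)).1 b = jacobian (fderiv ℝ X b) k l := by
  rw [dirDeriv_apply_of_forall (G := fun b => coords (X b) k) _ (fun _ => rfl) b]
  have hX := X.differentiableAt b.2
  fin_cases k
  · exact (fderiv_fst_apply hX _ 0).symm
  · exact (fderiv_fst_apply hX _ 1).symm
  · exact (fderiv_fst_apply hX _ 2).symm
  · exact (fderiv_snd_apply hX _ 0).symm
  · exact (fderiv_snd_apply hX _ 1).symm
  · exact (fderiv_snd_apply hX _ 2).symm

theorem dirDeriv_coordFun (k l : Fin 6) :
    dirDeriv (coordVec l) (coordFun W k) = if k = l then 1 else 0 := by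
  refine Subtype.ext <| funext fun b => ?_
  rw [dirDeriv_apply_of_forall (G := fun b => coords b k) _ (fun _ => rfl) b]
  have : fderiv ℝ (fun b => coords b k) b.1 (coordVec l) = coords (coordVec l) k := by
    fin_cases k
    · exact congrArg (fun D => D (coordVec l)) (fderiv_base_fst 0 _)
    · exact congrArg (fun D => D (coordVec l)) (fderiv_base_fst 1 _)
    · exact congrArg (fun D => D (coordVec l)) (fderiv_base_fst 2 _)
    · exact congrArg (fun D => D (coordVec l)) (fderiv_base_snd 0 _)
    · exact congrArg (fun D => D (coordVec l)) (fderiv_base_snd 1 _)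
    · exact congrArg (fun D => D (coordVec l)) (fderiv_base_snd 2 _)
  rw [this, coords_coordVec, Pi.single_apply]
  split_ifs <;> rfl

theorem dirDeriv_eq_zero {φ : smoothFunctions W} (h : ∀ l, dirDeriv (coordVec l) φ = 0)
    (w : BaseSpace) : dirDeriv w φ = 0 := by
  refine Subtype.ext <| funext fun b => ?_
  rw [dirDeriv_apply, eq_sum_coordVec w, map_sum]
  refine Finset.sum_eq_zero fun l _ => ?_
  rw [map_smul, ← dirDeriv_apply, h l]
  exact smul_zero _

variable (W) in
/-- The function `cos (f t)` on `W`. -/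
def cosFun (f : ℝ) : smoothFunctions W :=
  ofContDiffAt (fun b => Real.cos (f * b.1 0)) fun b => by fun_prop

variable (W) in
/-- The function `sin (f t)` on `W`. -/
def sinFun (f : ℝ) : smoothFunctions W :=
  ofContDiffAt (fun b => Real.sin (f * b.1 0)) fun b => by fun_prop

theorem dirDeriv_cosFun (f : ℝ) (l : Fin 6) :
    dirDeriv (coordVec l) (cosFun W f)
      = ![-(algebraMap ℝ _ f * sinFun W f), 0, 0, 0, 0, 0] l := by
  refine Subtype.ext <| funext fun b => ?_
  rw [dirDeriv_apply_of_forall (G := fun b => Real.cos (f * b.1 0)) _ (fun _ => rfl) b]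
  have : fderiv ℝ (fun b : BaseSpace => Real.cos (f * b.1 0)) b (coordVec l)
      = -(f * Real.sin (f * b.1.1 0)) * (coordVec l).1 0 := by
    simp (disch := fun_prop) [fderiv_cos, fderiv_fun_mul, fderiv_base_fst]
    ring
  rw [this]
  fin_cases l
  · exact mul_one _
  all_goals exact mul_zero _

theorem dirDeriv_sinFun (f : ℝ) (l : Fin 6) :
    dirDeriv (coordVec l) (sinFun W f)
      = ![algebraMap ℝ _ f * cosFun W f, 0, 0, 0, 0, 0] l := by
  refine Subtype.ext <| funext fun b => ?_
  rw [dirDeriv_apply_of_forall (G := fun b => Real.sin (f * b.1 0)) _ (fun _ => rfl) b]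
  have : fderiv ℝ (fun b : BaseSpace => Real.sin (f * b.1 0)) b (coordVec l)
      = (f * Real.cos (f * b.1.1 0)) * (coordVec l).1 0 := by
    simp (disch := fun_prop) [fderiv_sin, fderiv_fun_mul, fderiv_base_fst]
    ring
  rw [this]
  fin_cases l
  · exact mul_one _
  all_goals exact mul_zero _

/-! ### From a point symmetry to constant coefficients. -/

theorem equations_solutionJet (f g : ℝ) (b : BaseSpace) (a₁ a₂ b₁ b₂ c₁ c₂ : ℝ) :
    equations f g (b, solutionJet f g (b.2 0) (b.2 1) (b.2 2) a₁ a₂ b₁ b₂ c₁ c₂) = 0 := by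
  ext i
  fin_cases i <;> simp only [equations, solutionJet, Fin.reduceFinMk, Fin.zero_eta, Fin.mk_one,
    Matrix.cons_val, Pi.zero_apply] <;> ring

theorem IsPointSymmetry.determiningSystem {f g : ℝ} (hg : g ≠ 0) {X : SmoothVectorField W}
    (hX : IsPointSymmetry (equations f g) X) :
    DeterminingSystem (algebraMap ℝ (smoothFunctions W) f) (algebraMap ℝ _ g) (coordFun W 3)
      (coordFun W 4) (coordFun W 5) (component X)
      fun k l => dirDeriv (coordVec l) (component X k) := by
  rw [isPointSymmetry_iff] at hX
  have key : ∀ b : W, b.1.2 2 ≠ 0 → DeterminingSystem f g (b.1.2 0) (b.1.2 1) (b.1.2 2)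
      (fun k => (component X k).1 b)
      (fun k l => (dirDeriv (coordVec l) (component X k)).1 b) := fun b hb => by
    simp only [dirDeriv_component]
    exact determiningSystem_of_linearizedEquations hg hb fun a₁ a₂ b₁ b₂ c₁ c₂ =>
      hX b b.2 _ (equations_solutionJet f g b a₁ a₂ b₁ b₂ c₁ c₂)
  constructor <;> refine smoothFunctions_ext_of_ne fun b hb => ?_
  · exact (key b hb).t_x
  · exact (key b hb).t_y
  · exact (key b hb).t_u
  · exact (key b hb).t_v
  · exact (key b hb).t_h
  · exact (key b hb).x_u
  · exact (key b hb).x_v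
  · exact (key b hb).x_h
  · exact (key b hb).y_u
  · exact (key b hb).y_v
  · exact (key b hb).y_h
  · exact (key b hb).y_x
  · exact (key b hb).y_y
  · exact (key b hb).u_eq
  · exact (key b hb).v_eq
  · exact (key b hb).h_eq
  · exact (key b hb).momentum_u
  · exact (key b hb).momentum_v
  · exact (key b hb).mass

/-- Returns from identities of functions to identities at points, now including those with h = 0. -/
theorem DeterminingSystem.apply {f g : ℝ} {X : SmoothVectorField W}
    (h : DeterminingSystem (algebraMap ℝ (smoothFunctions W) f) (algebraMap ℝ _ g) (coordFun W 3)
      (coordFun W 4) (coordFun W 5) (component X)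
      fun k l => dirDeriv (coordVec l) (component X k)) (b : W) :
    DeterminingSystem f g (b.1.2 0) (b.1.2 1) (b.1.2 2) (coords (X b))
      (jacobian (fderiv ℝ X b)) := by
  have key : DeterminingSystem f g (b.1.2 0) (b.1.2 1) (b.1.2 2)
      (fun k => (component X k).1 b)
      (fun k l => (dirDeriv (coordVec l) (component X k)).1 b) := by
    have e {φ ψ : smoothFunctions W} (h : φ = ψ) : φ.1 b = ψ.1 b := by rw [h]
    exact ⟨e h.t_x, e h.t_y, e h.t_u, e h.t_v, e h.t_h, e h.x_u, e h.x_v, e h.x_h, e h.y_u,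
      e h.y_v, e h.y_h, e h.y_x, e h.y_y, e h.u_eq, e h.v_eq, e h.h_eq, e h.momentum_u,
      e h.momentum_v, e h.mass⟩
  simp only [dirDeriv_component] at key
  exact key

theorem IsPointSymmetry.exists_firstIntegralsAt_eq {f g : ℝ} (hg : g ≠ 0)
    (hW : IsConnected (W : Set BaseSpace)) {X : SmoothVectorField W}
    (hX : IsPointSymmetry (equations f g) X) (k : Fin 9) :
    ∃ r : ℝ, ∀ b : W, firstIntegralsAt f b X k = r := by
  have hd : ∀ l, dirDeriv (coordVec l)
      (firstIntegrals (algebraMap ℝ (smoothFunctions W) f) (cosFun W f) (sinFun W f)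
        (coordFun W 1) (coordFun W 2) (coordFun W 3) (coordFun W 4) (component X)
        (fun k l => dirDeriv (coordVec l) (component X k)) k) = 0 := fun l => by
    refine derivation_firstIntegrals_eq_zero (A := smoothFunctions W)
      (d := fun l => dirDeriv (coordVec l)) ?_ (hX.determiningSystem hg) ?_ ?_ ?_ ?_ ?_ ?_ ?_
      (dirDeriv_cosFun f) (dirDeriv_sinFun f) l k
    · exact fun i j φ => dirDeriv_comm _ _ φ
    -- Multiplication by h is injective on smooth functions, although h may have zeros in W.
    · exact fun φ hφ => smoothFunctions_ext_of_ne fun b hb =>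
        (mul_eq_zero_iff_left hb).1 (congrFun (congrArg Subtype.val hφ) b)
    · exact fun l => Derivation.map_algebraMap _ _
    all_goals
      intro l
      rw [dirDeriv_coordFun]
      fin_cases l <;> rfl
  obtain ⟨r, hr⟩ := exists_eq_const hW _ (dirDeriv_eq_zero hd)
  refine ⟨r, fun b => (hr b).symm.trans ?_ |>.symm⟩
  have : jacobian (fderiv ℝ X b) = fun k l => (dirDeriv (coordVec l) (component X k)).1 b := by
    ext k l
    rw [dirDeriv_component]
  change _ = firstIntegrals _ _ _ _ _ _ _ _ _ k
  rw [this]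
  fin_cases k <;> rfl

theorem IsPointSymmetry.mem_span {f g : ℝ} (hf : f ≠ 0) (hg : g ≠ 0)
    (hW : IsConnected (W : Set BaseSpace)) {X : SmoothVectorField W}
    (hX : IsPointSymmetry (equations f g) X) :
    X ∈ Submodule.span ℝ (Set.range (generatorOn f W)) := by
  choose r hr using hX.exists_firstIntegralsAt_eq hg hW
  have hf2 : 2 * f ^ 2 ≠ 0 := by positivity
  -- The first integrals are normalized to avoid denominators, so the expansion is that of 2f² X.
  rw [← (Submodule.span ℝ (Set.range (generatorOn f W))).smul_mem_iff hf2]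
  have hsum : ∀ (b : BaseSpace) (s : Finset (Fin 9)),
      (∑ j ∈ s, r j • generatorOn f W j : SmoothVectorField W) b
        = ∑ j ∈ s, r j • generatorOn f W j b := fun b s => by
    induction s using Finset.induction_on with
    | empty => rfl
    | insert j s hj ih =>
      rw [Finset.sum_insert hj, Finset.sum_insert hj, SmoothVectorField.add_apply, ih]
      rfl
  have : (2 * f ^ 2) • X = ∑ j, r j • generatorOn f W j := by
    refine SmoothVectorField.ext_on fun b hb => coords_injective (funext fun k => ?_)
    have h := eq_sum_firstIntegrals b ((hX.determiningSystem hg).apply ⟨b, hb⟩) k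
    rw [hsum, SmoothVectorField.smul_apply, coords_smul, Pi.smul_apply, smul_eq_mul, h]
    have hc : coords (∑ j, r j • generatorOn f W j b) k
        = ∑ j, r j * coords (generatorOn f W j b) k := by
      let L : BaseSpace →+ (Fin 6 → ℝ) :=
        ⟨⟨coords, by ext k; fin_cases k <;> rfl⟩, coords_add⟩
      change L _ k = _
      rw [map_sum, Finset.sum_apply]
      exact Finset.sum_congr rfl fun j _ => congrFun (coords_smul _ _) k
    rw [hc]
    refine Finset.sum_congr rfl fun j _ => ?_
    rw [generatorOn_apply f j hb, ← hr j ⟨b, hb⟩]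
    rfl
  rw [this]
  exact Submodule.sum_mem _ fun j _ =>
    Submodule.smul_mem _ _ (Submodule.subset_span ⟨j, rfl⟩)

end RSW

end

theorem theorem1 (f g : ℝ) (hf : f ≠ 0) (hg : g ≠ 0)
    (W : TopologicalSpace.Opens RSW.BaseSpace) (hW : IsConnected (W : Set RSW.BaseSpace)) :
    ∃ L : LieSubalgebra ℝ (RSW.SmoothVectorField W),
      (∀ X : RSW.SmoothVectorField W, X ∈ L ↔ RSW.IsPointSymmetry (RSW.equations f g) X) ∧
      L.toSubmodule = Submodule.span ℝ (Set.range (RSW.generatorOn f W)) ∧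
      LinearIndependent ℝ (RSW.generatorOn f W) ∧
      Module.finrank ℝ L = 9 := by
  have hli := RSW.linearIndependent_generatorOn (W := W) hf hW.nonempty
  -- Taking the span itself as the subalgebra makes the second claim definitional; the first then
  -- carries the classification.
  refine ⟨{ Submodule.span ℝ (Set.range (RSW.generatorOn f W)) with
      lie_mem' := fun hX hY => RSW.lie_mem_span hX hY }, fun X => ?_, rfl, hli, ?_⟩
  · exact ⟨fun hX => RSW.isPointSymmetry_of_mem_span hX, fun hX => hX.mem_span hf hg hW⟩
  · exact (finrank_span_eq_card hli).trans (by simp)
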